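/- Let $\|\cdot\|_e$ be the Euclidean norm on $\mathbb{R}^2$. For $\alpha\in\mathbb{R}^2$ with at least one irrational coordinate and a positive integer $q$ put $\delta_q=\delta_q(\alpha)=\min_{p\in\mathbb{Z}^2}\|q\alpha-p\|_e$, and let $1=q_1<q_2<\cdots$ be the sequence of denominators of best simultaneous approximations to $\alpha$, that is, of all positive integers $Q$ such that $\delta_q>\delta_Q$ for every integer $q$ with $1\le q<Q$. Put $g(\alpha,\|\cdot\|_e)=\liminf_{k\to\infty}q_k^{1/k}\in[1,\infty]$ and $G(2,\|\cdot\|_e)=\inf_{\alpha\in\mathbb{R}^2\setminus\mathbb{Q}^2}g(\alpha,\|\cdot\|_e)$. Then $$G(2,\|\cdot\|_e)\ge 1.228043;$$ in particular $\liminf_{k\to\infty}q_k^{1/k}\ge 1.228043$ for every $\alpha\in\mathbb{R}^2$ with at least one irrational coordinate. -/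

import Mathlib

open Filter

noncomputable section

/-- The integer vector `p : Fin n → ℤ` as a point of Euclidean space. -/
def intPoint {n : ℕ} (p : Fin n → ℤ) : EuclideanSpace ℝ (Fin n) :=
  WithLp.toLp 2 (fun i => (p i : ℝ))

/-- `δ_q = min_{p ∈ ℤⁿ} ‖q • α - p‖`, the Euclidean distance from `q • α` to the integer
lattice. The infimum is attained, see `exists_delta_eq`. -/
def delta {n : ℕ} (α : EuclideanSpace ℝ (Fin n)) (q : ℕ) : ℝ :=
  ⨅ p : Fin n → ℤ, ‖(q : ℝ) • α - intPoint p‖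

theorem exists_delta_eq {n : ℕ} (α : EuclideanSpace ℝ (Fin n)) (q : ℕ) :
    ∃ p : Fin n → ℤ, delta α q = ‖(q : ℝ) • α - intPoint p‖ := by
  refine ⟨fun i => round ((q : ℝ) * α i), le_antisymm ?_ ?_⟩
  · exact ciInf_le ⟨0, by rintro _ ⟨p, rfl⟩; exact norm_nonneg _⟩ _
  · refine le_ciInf fun p => ?_
    rw [EuclideanSpace.norm_eq, EuclideanSpace.norm_eq]
    refine Real.sqrt_le_sqrt (Finset.sum_le_sum fun i _ => ?_)
    have h := round_le ((q : ℝ) * α i) (p i)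
    simp only [intPoint, PiLp.sub_apply, PiLp.smul_apply, smul_eq_mul, Real.norm_eq_abs]
    exact pow_le_pow_left₀ (abs_nonneg _) h 2

/-- `Q` is a denominator of a best simultaneous approximation to `α`: a positive integer with
`δ_q > δ_Q` for all positive integers `q < Q`. -/
def IsBestDenominator {n : ℕ} (α : EuclideanSpace ℝ (Fin n)) (Q : ℕ) : Prop :=
  1 ≤ Q ∧ ∀ q : ℕ, 1 ≤ q → q < Q → delta α Q < delta α q

/-- The sequence `q_1 < q_2 < ⋯` of all denominators of best approximations to `α`, in increasing
order and indexed from `k = 1` (the value at `k = 0` is irrelevant). -/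
def bestDenominator {n : ℕ} (α : EuclideanSpace ℝ (Fin n)) (k : ℕ) : ℕ :=
  Nat.nth (IsBestDenominator α) (k - 1)

theorem isBestDenominator_one {n : ℕ} (α : EuclideanSpace ℝ (Fin n)) :
    IsBestDenominator α 1 :=
  ⟨le_rfl, fun _ h h' => absurd h (not_le.mpr h')⟩

theorem bestDenominator_one {n : ℕ} (α : EuclideanSpace ℝ (Fin n)) :
    bestDenominator α 1 = 1 := by
  classical
  have h0 : ¬ IsBestDenominator α 0 := fun h => absurd h.1 (by norm_num)
  have h := Nat.nth_count (isBestDenominator_one α)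
  have hc : Nat.count (IsBestDenominator α) 1 = 0 := by
    simp [Nat.count_succ, h0]
  rw [hc] at h
  exact h

/-- `g(α) = liminf_{k → ∞} q_k ^ (1/k)`, an extended real number (it is `⊤` if `q_k` grows
faster than every geometric progression). -/
def growthExponent {n : ℕ} (α : EuclideanSpace ℝ (Fin n)) : EReal :=
  liminf (fun k : ℕ => (((bestDenominator α k : ℝ) ^ (1 / (k : ℝ)) : ℝ) : EReal)) atTop

/-- `G(n) = inf g(α)` over all `α ∈ ℝⁿ \ ℚⁿ`, for the Euclidean norm on `ℝⁿ`. -/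
def minGrowthExponent (n : ℕ) : EReal :=
  ⨅ α : {α : EuclideanSpace ℝ (Fin n) // ∃ i, Irrational (α i)}, growthExponent α.1

end

/-!
Let `Q 0 < Q 1 < ⋯` be the denominators of best approximations of `α`. Everything rests on the
recursive inequality `Q (k + 4) ≥ min (2 * Q (k + 1)) (Q k + Q (k + 2))`
(`min_le_nth_isBestDenominator`). Since `(5 / 4) ^ 4` is less than both `2 * (5 / 4)` and
`1 + (5 / 4) ^ 2`, it gives `Q k ≥ c * (5 / 4) ^ k` by induction, so the lower limit of the
`k`-th roots is at least `5 / 4`, more than the required constant.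

Suppose the recursive inequality fails. Let `A, B, C, D, E` be the residues `q α - p` of the five
best approximations with denominators `Q k, …, Q (k + 4)`, viewed as complex numbers of decreasing
length. An integer combination of these approximations whose denominator is less than `Q (j + 1)`
in absolute value, and which is not zero, has a residue at least as long as the `j`-th one
(`delta_nth_le_norm_residue`). As the denominators are close to each other, this bounds from below
the residues `X - Y` and `X + Y - Z` for most choices of `X, Y, Z` among the five vectors. That
these bounds are incompatible is a statement of plane geometry, `planar_configuration`, which
combines two facts.

* The cone lemma (`norm_add_sub_lt`): if `E` lies in the cone spanned by `A` and `X`, is no longer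
  than either, and is far enough from both, then `A + X - E` is short. Hence `E` lies in no cone
  spanned by two of the other vectors, unless `A + B = E`, and so the other vectors lie in a
  half-plane. In the same way `D` is not between `B` and `C`, and it is not between `A` and `B`
  unless `A + B = D`.
* The law of cosines bounds the angles between the vectors from below. Let `τ` be the base angle of
  the isosceles triangle with sides `‖A‖, ‖B‖, ‖B‖`; it is less than `π / 3`. Two of `B, C, D`
  form an angle more than `π - 2 τ`, and `A` and `B` form an angle more than `π / 3`. The angle of
  `A` and `C` is at least `τ`, or that of `B` and `C` is at least `2 τ`; the angle of `A` and `D`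
  is at least `τ`, or those of `B, D` and of `C, D` are at least `2 τ`. In every order of the
  directions in the half-plane these angles add up to more than `π` (`four_directions`).

If `A + B` is `D` or `E`, then `A` and `B` form an angle more than `π - τ`, and `C` is not between
them; in this case `A, B, C` alone give the contradiction (`three_directions`). For `A + B = E` the
half-plane that contains them comes from the cone lemma for `D` in place of `E`.
-/

section PlaneGeometry

open Real Set

/-! ### The cone lemma in coordinates -/

/-- The part of the cone lemma in which `(a, p)` and `(-c, -y)` lie on different sides of the line
through the origin perpendicular to `(t, 0)`. -/
theorem cone_opposite_signs {t a p c y : ℝ} (ht : 0 < t) (ha : 0 ≤ a) (hat : 2 * a ≤ t)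
    (hp : 0 ≤ p) (hc : 0 ≤ c) (hy : 0 ≤ y) (hcone : c * p ≤ a * y) (hA : t ^ 2 ≤ a ^ 2 + p ^ 2)
    (hX : t ^ 2 ≤ c ^ 2 + y ^ 2) :
    (t - a + c) ^ 2 + (p - y) ^ 2 ≤ t ^ 2 ∨ (t - a + c) ^ 2 + (p - y) ^ 2 < a ^ 2 + p ^ 2 ∨
      (t - a + c) ^ 2 + (p - y) ^ 2 < c ^ 2 + y ^ 2 := by
  have hp0 : 0 < p := by
    rcases hp.lt_or_eq with h | h
    · exact h
    · subst h; nlinarith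
  rcases le_or_gt y p with hyp | hyp
  · -- `c ≤ k a` and `y = k p`, so `t` is at most `k` times the length of `(a, p)`
    obtain ⟨k, hk⟩ : ∃ k, k = y / p := ⟨_, rfl⟩
    have hyk : y = k * p := by rw [hk]; field_simp
    subst hyk
    have hk0 : 0 ≤ k := by rw [hk]; positivity
    have hk1 : k ≤ 1 := by nlinarith
    have hck : c ≤ a * k := by nlinarith
    have hc2 : c ^ 2 ≤ (a * k) ^ 2 := by gcongr
    have ht2 : t ^ 2 ≤ k ^ 2 * (a ^ 2 + p ^ 2) := by nlinarith
    have h1 : (t - a + c) ^ 2 ≤ (t - a + a * k) ^ 2 := by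
      gcongr
      linarith
    have hW : (t - a + c) ^ 2 + (p - k * p) ^ 2 ≤
        t ^ 2 - 2 * (t * a) * (1 - k) + (1 - k) ^ 2 * (a ^ 2 + p ^ 2) := by nlinarith
    have hta : 0 ≤ t * a := by positivity
    rcases hk1.lt_or_eq with hk1 | hk1
    · right; left
      have hk0' : 0 < k := by
        rcases hk0.lt_or_eq with h | h
        · exact h
        · rw [← h] at ht2; nlinarith
      have h2 : 0 < 2 * k * (1 - k) * (a ^ 2 + p ^ 2) := by
        have : 0 < 1 - k := by linarith
        positivity
      have h3 : 0 ≤ (t * a) * (1 - k) := mul_nonneg hta (by linarith)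
      nlinarith
    · left; rw [hk1] at hW ⊢; nlinarith
  · right; right
    have h1 : 0 < a ^ 2 + p ^ 2 - t * a := by nlinarith
    have h2 : (t - a) * (c * p) ≤ (t - a) * (a * y) :=
      mul_le_mul_of_nonneg_left hcone (by linarith)
    have h3 : p * (t ^ 2 - 2 * t * a + (a ^ 2 + p ^ 2) + 2 * (t - a) * c - 2 * y * p) < 0 := by
      nlinarith [mul_pos (sub_pos.2 hyp) h1, mul_nonneg hp (sub_nonneg.2 hA)]
    have h4 := neg_of_mul_neg_right h3 hp
    nlinarith

/-- The cone lemma, in coordinates for which `E = (t, 0)`, `A = (a, p)` and `X = (x, -y)`. The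
hypotheses `hcone` and `hax` say that `E` lies in the cone spanned by `A` and `X`. -/
theorem cone_coord {ρ σ t a p x y : ℝ} (ht : 0 < t) (hσ : 0 < σ) (hσρ : σ < ρ) (hp : 0 ≤ p)
    (hy : 0 ≤ y) (hcone : 0 ≤ a * y + x * p) (hax : 0 ≤ a ∨ 0 ≤ x) (hA : t ^ 2 ≤ a ^ 2 + p ^ 2)
    (hAρ : a ^ 2 + p ^ 2 ≤ ρ ^ 2) (hX : t ^ 2 ≤ x ^ 2 + y ^ 2) (hXσ : x ^ 2 + y ^ 2 ≤ σ ^ 2)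
    (hXE : ρ ^ 2 ≤ (x - t) ^ 2 + y ^ 2) (hAE : σ ^ 2 ≤ (a - t) ^ 2 + p ^ 2) :
    (a + x - t) ^ 2 + (p - y) ^ 2 < ρ ^ 2 := by
  have hsq : σ ^ 2 < ρ ^ 2 := by gcongr
  have h2x : 2 * x < t := by nlinarith
  have hv : a + x ≤ t := by nlinarith
  have htσ : t ^ 2 ≤ σ ^ 2 := hX.trans hXσ
  rcases le_or_gt (2 * a) t with h2a | h2a
  · rcases le_or_gt 0 a with ha | ha
    · rcases le_or_gt 0 x with hx | hx
      · rcases le_or_gt p y with hpy | hpy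
        · have hpt : t - a ≤ p := by
            refine abs_le_of_sq_le_sq' ?_ hp |>.2
            linarith [mul_nonneg ha (show 0 ≤ t - a by linarith)]
          have h1 : (a + x - t) ^ 2 ≤ p ^ 2 := sq_le_sq' (by linarith) (by linarith)
          have h2 : 0 ≤ p * (y - p) := mul_nonneg hp (by linarith)
          linarith [sq_nonneg x]
        · have hyt : t - x ≤ y := by
            refine abs_le_of_sq_le_sq' ?_ hy |>.2
            linarith [mul_nonneg hx (show 0 ≤ t - x by linarith)]
          have h1 : (a + x - t) ^ 2 ≤ y ^ 2 := sq_le_sq' (by linarith) (by linarith)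
          have h2 : 0 < y * (p - y) := mul_pos (by linarith) (by linarith)
          linarith [sq_nonneg a]
      · have := cone_opposite_signs (c := -x) ht ha h2a hp (by linarith) hy (by linarith) hA
          (by linarith)
        rw [neg_sq, show t - a + -x = -(a + x - t) by ring, neg_sq] at this
        rcases this with h | h | h <;> linarith
    · have hx : 0 ≤ x := hax.resolve_left (not_le.2 ha)
      have := cone_opposite_signs (c := -a) ht hx h2x.le hy (by linarith) hp (by linarith) hX
        (by linarith)
      rw [neg_sq, show t - x + -a = -(a + x - t) by ring, neg_sq,
        show (y - p) ^ 2 = (p - y) ^ 2 by ring] at this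
      rcases this with h | h | h <;> linarith
  · rcases lt_or_ge p y with hpy | hpy
    · -- `p < y` means `|x| < |t - a|`, which together with `a + x ≤ t` forces `a < t`
      have h1 : (p - y) ^ 2 ≤ y ^ 2 - p ^ 2 := by nlinarith
      have h2 : p ^ 2 < y ^ 2 := by gcongr
      have h3 : x ^ 2 < (t - a) ^ 2 := by nlinarith
      have h4 : 0 < t - a := by
        by_contra! h
        nlinarith
      have h5 : -x < t - a := by nlinarith
      have h6 : (a + x - t) ^ 2 + (p - y) ^ 2 ≤ 2 * (t - a) * (t - a - x) := by nlinarith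
      nlinarith
    · obtain ⟨v, hv'⟩ : ∃ v, v = t - x := ⟨_, rfl⟩
      have hx : x = t - v := by linarith
      subst hx
      suffices h : v ^ 2 - 2 * a * v < 2 * p * y - y ^ 2 by nlinarith
      have hyy : 0 ≤ 2 * p * y - y ^ 2 := by nlinarith
      rcases lt_or_ge v (2 * a) with hva | hva
      · nlinarith
      · -- the squares are compared after multiplication by `p ^ 2`, using `v p ≤ t p + a y`
        have hvt : t < v := by linarith
        rcases hy.lt_or_eq with hy0 | hy0
        · have hp0 : 0 < p := by linarith
          have ha0 : 0 < a := by linarith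
          have h1 : v * p ≤ t * p + a * y := by linarith
          have h2 : v * p * (v * p - 2 * a * p) ≤
              (t * p + a * y) * (t * p + a * y - 2 * a * p) := by
            apply mul_le_mul h1 (by linarith) _ (by positivity)
            linarith [mul_nonneg (sub_nonneg.2 hva) hp]
          have h3 : 2 * a * t - a ^ 2 ≤ p ^ 2 := by linarith
          have h4 : (2 * a * t - a ^ 2) * (y * (2 * p - y)) ≤ p ^ 2 * (y * (2 * p - y)) :=
            mul_le_mul_of_nonneg_right h3 (mul_nonneg hy (by linarith))
          have h5 : 0 < p ^ 2 * (t * (2 * a - t)) := by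
            have : 0 < 2 * a - t := by linarith
            positivity
          have h6 : 0 ≤ a * t * (y * (p - y)) := by
            have : 0 ≤ p - y := by linarith
            positivity
          have h7 : p ^ 2 * (v ^ 2 - 2 * a * v) < p ^ 2 * (2 * p * y - y ^ 2) := by linarith
          exact lt_of_mul_lt_mul_left h7 (by positivity)
        · subst hy0
          have hp0 : p = 0 := by
            refine le_antisymm ?_ hp
            by_contra! h
            linarith [mul_pos h (sub_pos.2 hvt)]
          subst hp0
          have h1 : v - t ≤ σ := by
            refine abs_le_of_sq_le_sq' ?_ hσ.le |>.2
            linarith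
          have htσ' : t ≤ σ := abs_le_of_sq_le_sq' htσ hσ.le |>.2
          have h2 : σ ≤ a - t := by
            by_contra! h
            linarith [sq_lt_sq' (show -σ < a - t by linarith) h]
          linarith [mul_pos (show 0 < v by linarith) (show 0 < 2 * a - v by linarith)]

/-! ### Directions in a half-plane -/

/-- Three directions in a half-plane, the third not between the first two, cannot form angles this
large. -/
theorem three_directions {a b c τ : ℝ} (hτ : τ < π / 3) (hac : |a - c| ≤ π)
    (hbc : |b - c| ≤ π) (gab : π - τ < |a - b|) (gac : π / 3 < |a - c|) (gbc : π / 3 < |b - c|)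
    (hc : c ∉ uIcc a b) : False := by
  rw [mem_uIcc] at hc
  rw [abs_le] at hac hbc
  rw [lt_abs] at gab gac gbc
  grind

/-- Four directions in a half-plane, the last one being extreme, cannot form angles this large:
for each of the six orders of the others, some consecutive angles add up to more than `π`. -/
theorem four_directions {a b c d τ : ℝ} (hτ : τ < π / 3) (had : |a - d| ≤ π)
    (hbd : |b - d| ≤ π) (hcd : |c - d| ≤ π) (gab : π / 3 < |a - b|) (gbc : π - 2 * τ < |b - c|)
    (gbd : π - 2 * τ < |b - d|) (gcd : π - 2 * τ < |c - d|)
    (gc : τ ≤ |a - c| ∨ 2 * τ ≤ |b - c|)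
    (gd : τ ≤ |a - d| ∨ 2 * τ ≤ |b - d| ∧ 2 * τ ≤ |c - d|)
    (hdab : d ∉ uIcc a b) (hdbc : d ∉ uIcc b c) : False := by
  rw [mem_uIcc] at hdab hdbc
  rw [abs_le] at had hbd hcd
  rw [lt_abs] at gab gbc
  rcases le_total a d with hda | hda
  · -- `d` is the largest of the four
    have h1 : b ≤ d := by grind
    have h2 : c ≤ d := by grind
    rw [abs_sub_comm b, abs_of_nonneg (sub_nonneg.2 h1)] at gbd gd
    rw [abs_sub_comm c, abs_of_nonneg (sub_nonneg.2 h2)] at gcd gd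
    rw [abs_sub_comm a, abs_of_nonneg (sub_nonneg.2 hda)] at gd
    grind
  · -- `d` is the smallest of the four
    have h1 : d ≤ b := by grind
    have h2 : d ≤ c := by grind
    rw [abs_of_nonneg (sub_nonneg.2 h1)] at gbd gd
    rw [abs_of_nonneg (sub_nonneg.2 h2)] at gcd gd
    rw [abs_of_nonneg (sub_nonneg.2 hda)] at gd
    grind

/-! ### Arguments of complex numbers -/

/-- `θ` is an argument of the complex number `z`, not necessarily the principal one. -/
def IsArg (z : ℂ) (θ : ℝ) : Prop :=
  z.re = ‖z‖ * cos θ ∧ z.im = ‖z‖ * sin θ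

theorem isArg_arg (z : ℂ) : IsArg z z.arg :=
  ⟨(Complex.norm_mul_cos_arg z).symm, (Complex.norm_mul_sin_arg z).symm⟩

theorem IsArg.add_two_pi {z : ℂ} {θ : ℝ} (h : IsArg z θ) : IsArg z (θ + 2 * π) := by
  simpa [IsArg] using h

theorem exists_isArg (z : ℂ) (c : ℝ) : ∃ θ, IsArg z θ ∧ c ≤ θ ∧ θ < c + 2 * π := by
  obtain ⟨h1, h2⟩ := toIcoMod_mem_Ico two_pi_pos c z.arg
  refine ⟨toIcoMod two_pi_pos c z.arg, ?_, h1, h2⟩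
  rw [toIcoMod, zsmul_eq_mul]
  have h := isArg_arg z
  rwa [IsArg, ← cos_sub_int_mul_two_pi z.arg (toIcoDiv two_pi_pos c z.arg),
    ← sin_sub_int_mul_two_pi z.arg (toIcoDiv two_pi_pos c z.arg)] at h

theorem sq_norm_eq (z : ℂ) : ‖z‖ ^ 2 = z.re ^ 2 + z.im ^ 2 := by
  rw [Complex.sq_norm, Complex.normSq_apply]; ring

theorem sq_norm_sub {z w : ℂ} {θ φ : ℝ} (hz : IsArg z θ) (hw : IsArg w φ) :
    ‖z - w‖ ^ 2 = ‖z‖ ^ 2 + ‖w‖ ^ 2 - 2 * ‖z‖ * ‖w‖ * cos (θ - φ) := by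
  rw [sq_norm_eq (z - w), Complex.sub_re, Complex.sub_im, hz.1, hz.2, hw.1, hw.2, cos_sub]
  linear_combination ‖z‖ ^ 2 * sin_sq_add_cos_sq θ + ‖w‖ ^ 2 * sin_sq_add_cos_sq φ

theorem sq_norm_add {z w : ℂ} {θ φ : ℝ} (hz : IsArg z θ) (hw : IsArg w φ) :
    ‖z + w‖ ^ 2 = ‖z‖ ^ 2 + ‖w‖ ^ 2 + 2 * ‖z‖ * ‖w‖ * cos (θ - φ) := by
  rw [sq_norm_eq (z + w), Complex.add_re, Complex.add_im, hz.1, hz.2, hw.1, hw.2, cos_sub]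
  linear_combination ‖z‖ ^ 2 * sin_sq_add_cos_sq θ + ‖w‖ ^ 2 * sin_sq_add_cos_sq φ

theorem sq_norm_add_sub {A X E : ℂ} {α β ε : ℝ} (hA : IsArg A α) (hX : IsArg X β)
    (hE : IsArg E ε) :
    ‖A + X - E‖ ^ 2 = ‖A‖ ^ 2 + ‖X‖ ^ 2 + ‖E‖ ^ 2 + 2 * ‖A‖ * ‖X‖ * cos (α - β) -
      2 * ‖A‖ * ‖E‖ * cos (α - ε) - 2 * ‖X‖ * ‖E‖ * cos (β - ε) := by
  rw [sq_norm_eq (A + X - E), Complex.sub_re, Complex.sub_im, Complex.add_re, Complex.add_im,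
    hA.1, hA.2, hX.1, hX.2, hE.1, hE.2, cos_sub, cos_sub, cos_sub]
  linear_combination ‖A‖ ^ 2 * sin_sq_add_cos_sq α + ‖X‖ ^ 2 * sin_sq_add_cos_sq β +
    ‖E‖ ^ 2 * sin_sq_add_cos_sq ε

/-- The cone lemma. The hypotheses on the arguments say that `E` lies in the cone spanned by `A`
and `X`. -/
theorem norm_add_sub_lt {A X E : ℂ} {α β ε ρ σ : ℝ} (hA : IsArg A α) (hX : IsArg X β)
    (hE : IsArg E ε) (hαβ : |α - β| ≤ π) (hε : ε ∈ uIcc α β) (hE0 : E ≠ 0) (hσρ : σ < ρ)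
    (hEA : ‖E‖ ≤ ‖A‖) (hAρ : ‖A‖ ≤ ρ) (hEX : ‖E‖ ≤ ‖X‖) (hXσ : ‖X‖ ≤ σ) (hXE : ρ ≤ ‖X - E‖)
    (hAE : σ ≤ ‖A - E‖) : ‖A + X - E‖ < ρ := by
  -- the angles from `E` to `A` and to `X`
  obtain ⟨u, v, hu, hv, huv, h1, h2, h3⟩ : ∃ u v : ℝ, 0 ≤ u ∧ 0 ≤ v ∧ u + v ≤ π ∧
      cos (α - β) = cos (u + v) ∧ cos (α - ε) = cos u ∧ cos (β - ε) = cos v := by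
    rw [abs_le] at hαβ
    rcases mem_uIcc.1 hε with h | h
    · refine ⟨ε - α, β - ε, by linarith, by linarith, by linarith, ?_, ?_, rfl⟩
      · rw [← cos_neg]; ring_nf
      · rw [← cos_neg]; ring_nf
    · refine ⟨α - ε, ε - β, by linarith, by linarith, by linarith, ?_, rfl, ?_⟩
      · ring_nf
      · rw [← cos_neg]; ring_nf
  have ht : 0 < ‖E‖ := norm_pos_iff.2 hE0
  have hσ : 0 < σ := by linarith
  have hρ : 0 < ρ := by linarith
  have hu' : 0 ≤ sin u := sin_nonneg_of_nonneg_of_le_pi hu (by linarith)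
  have hv' : 0 ≤ sin v := sin_nonneg_of_nonneg_of_le_pi hv (by linarith)
  have huv' : 0 ≤ sin (u + v) := sin_nonneg_of_nonneg_of_le_pi (by linarith) huv
  have eu := sin_sq_add_cos_sq u
  have ev := sin_sq_add_cos_sq v
  have eA : (‖A‖ * cos u) ^ 2 + (‖A‖ * sin u) ^ 2 = ‖A‖ ^ 2 := by
    linear_combination ‖A‖ ^ 2 * eu
  have eX : (‖X‖ * cos v) ^ 2 + (‖X‖ * sin v) ^ 2 = ‖X‖ ^ 2 := by
    linear_combination ‖X‖ ^ 2 * ev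
  have key := cone_coord (ρ := ρ) (σ := σ) (t := ‖E‖) (a := ‖A‖ * cos u) (p := ‖A‖ * sin u)
    (x := ‖X‖ * cos v) (y := ‖X‖ * sin v) ht hσ hσρ (by positivity) (by positivity) ?_ ?_
    (by rw [eA]; gcongr) (by rw [eA]; gcongr) (by rw [eX]; gcongr) (by rw [eX]; gcongr) ?_ ?_
  · refine lt_of_pow_lt_pow_left₀ 2 hρ.le (lt_of_eq_of_lt ?_ key)
    rw [sq_norm_add_sub hA hX hE, h1, h2, h3, cos_add]
    linear_combination -eA - eX
  · have : 0 ≤ ‖A‖ * ‖X‖ * sin (u + v) := by positivity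
    rw [sin_add] at this
    linarith
  · rcases le_total u (π / 2) with h | h
    · exact Or.inl (mul_nonneg (norm_nonneg _) (cos_nonneg_of_neg_pi_div_two_le_of_le
        (by linarith [pi_pos]) h))
    · exact Or.inr (mul_nonneg (norm_nonneg _) (cos_nonneg_of_neg_pi_div_two_le_of_le
        (by linarith [pi_pos]) (by linarith)))
  · calc ρ ^ 2 ≤ ‖X - E‖ ^ 2 := by gcongr
      _ = _ := by rw [sq_norm_sub hX hE, h3]; linear_combination -eX
  · calc σ ^ 2 ≤ ‖A - E‖ ^ 2 := by gcongr
      _ = _ := by rw [sq_norm_sub hA hE, h2]; linear_combination -eA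

theorem notMem_uIcc {A X E : ℂ} {α β ε ρ σ : ℝ} (hA : IsArg A α) (hX : IsArg X β)
    (hE : IsArg E ε) (hαβ : |α - β| ≤ π) (hE0 : E ≠ 0) (hσρ : σ < ρ)
    (hEA : ‖E‖ ≤ ‖A‖) (hAρ : ‖A‖ ≤ ρ) (hEX : ‖E‖ ≤ ‖X‖) (hXσ : ‖X‖ ≤ σ) (hXE : ρ ≤ ‖X - E‖)
    (hAE : σ ≤ ‖A - E‖) (h : ρ ≤ ‖A + X - E‖) : ε ∉ uIcc α β := fun hε =>
  (norm_add_sub_lt hA hX hE hαβ hε hE0 hσρ hEA hAρ hEX hXσ hXE hAE).not_ge h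

/-- If arguments of `A` and `X` are chosen in the full turn that starts at an argument of `E`, then
they differ by at most `π`: otherwise the end of this turn, which is again an argument of `E`, lies
in the cone spanned by `A` and `X`. -/
theorem abs_sub_le_pi {A X E : ℂ} {α β ε ρ σ : ℝ} (hA : IsArg A α) (hX : IsArg X β)
    (hE : IsArg E ε) (hα : ε ≤ α ∧ α < ε + 2 * π) (hβ : ε ≤ β ∧ β < ε + 2 * π) (hE0 : E ≠ 0)
    (hσρ : σ < ρ) (hEA : ‖E‖ ≤ ‖A‖) (hAρ : ‖A‖ ≤ ρ) (hEX : ‖E‖ ≤ ‖X‖) (hXσ : ‖X‖ ≤ σ)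
    (hXE : ρ ≤ ‖X - E‖) (hAE : σ ≤ ‖A - E‖) (h : ρ ≤ ‖A + X - E‖) : |α - β| ≤ π := by
  by_contra! hlt
  rcases lt_abs.1 hlt with h' | h'
  · refine notMem_uIcc hA hX.add_two_pi hE.add_two_pi ?_ hE0 hσρ hEA hAρ hEX hXσ hXE hAE h
      (mem_uIcc.2 (Or.inl ⟨by linarith, by linarith⟩))
    rw [abs_le]; constructor <;> linarith
  · refine notMem_uIcc hA.add_two_pi hX hE.add_two_pi ?_ hE0 hσρ hEA hAρ hEX hXσ hXE hAE h
      (mem_uIcc.2 (Or.inr ⟨by linarith, by linarith⟩))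
    rw [abs_le]; constructor <;> linarith

/-! ### Five vectors in the plane -/

theorem lt_abs_of_cos_lt {κ g : ℝ} (hκ : κ ≤ π) (hg : cos g < cos κ) :
    κ < |g| := by
  by_contra! h
  have := cos_le_cos_of_nonneg_of_le_pi (abs_nonneg g) hκ h
  rw [cos_abs] at this
  linarith

theorem le_abs_of_cos_le {κ g : ℝ} (hκ0 : 0 ≤ κ) (hg' : |g| ≤ π) (hκ : κ ≤ π)
    (hg : cos g ≤ cos κ) : κ ≤ |g| := by
  rw [← cos_abs g] at hg
  exact (strictAntiOn_cos.le_iff_ge ⟨abs_nonneg g, hg'⟩ ⟨hκ0, hκ⟩).1 hg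

theorem cos_lt_half {x R c : ℝ} (hx : 0 < x) (hxR : x < R)
    (h : R ^ 2 ≤ R ^ 2 + x ^ 2 - 2 * R * x * c) : c < 1 / 2 := by
  by_contra! hc
  have : 0 < R * x := mul_pos (by linarith) hx
  nlinarith

/-- Two vectors no longer than `b` at distance at least `R > b` form an angle larger than the apex
angle of the triangle with sides `R, b, b`. -/
theorem cos_lt_of_norm_le {x y b R c : ℝ} (hx : 0 < x) (hy : 0 < y) (hxb : x ≤ b) (hyb : y < b)
    (hbR : b < R) (h : R ^ 2 ≤ x ^ 2 + y ^ 2 - 2 * x * y * c) : c < 1 - R ^ 2 / (2 * b ^ 2) := by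
  have hb : 0 < b := by linarith
  have h1 : x ^ 2 - x * y + y ^ 2 < b ^ 2 := by nlinarith
  have h2 : b ^ 2 * (x - y) ^ 2 < R ^ 2 * (b ^ 2 - x * y) := by
    calc b ^ 2 * (x - y) ^ 2 ≤ R ^ 2 * (x - y) ^ 2 := by gcongr
      _ < R ^ 2 * (b ^ 2 - x * y) := by
        have : 0 < R := by linarith
        gcongr; nlinarith
  have h3 : x * y * (2 * b ^ 2 * c) < x * y * (2 * b ^ 2 - R ^ 2) := by nlinarith
  have h4 := lt_of_mul_lt_mul_left h3 (by positivity)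
  rw [lt_sub_iff_add_lt, ← lt_sub_iff_add_lt', div_lt_iff₀ (by positivity)]
  linarith

/-- `R / (2 * b)` is the cosine of the base angle of the triangle with sides `R, b, b`. The cosine
of the angle opposite to `b` in the triangle with sides `R, x, b` is convex in `x`, and it takes
this value for `b * x = R ^ 2 - b ^ 2` and for `x = b`. -/
theorem cos_le_of_le {x b R c : ℝ} (hx : 0 < x) (hxb : x ≤ b) (hR : 0 < R)
    (hbx : R ^ 2 - b ^ 2 ≤ b * x) (h : b ^ 2 ≤ R ^ 2 + x ^ 2 - 2 * R * x * c) :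
    c ≤ R / (2 * b) := by
  have hb : 0 < b := by linarith
  rw [le_div_iff₀ (by positivity)]
  have h1 : 0 ≤ (b - x) * (b * x - (R ^ 2 - b ^ 2)) :=
    mul_nonneg (by linarith) (by linarith)
  have h2 : R * x * (c * (2 * b)) ≤ R * x * R := by nlinarith
  exact le_of_mul_le_mul_left h2 (by positivity)

/-- `R ^ 2 / (2 * b ^ 2) - 1` is the cosine of twice the base angle of the triangle with sides
`R, b, b`. -/
theorem cos_le_of_ge {x y b R c : ℝ} (hx : 0 < x) (hy : 0 < y) (hyb : y ≤ b) (hxR : x ≤ R)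
    (hbx : b * x ≤ R ^ 2 - b ^ 2) (h : R ^ 2 ≤ x ^ 2 + y ^ 2 - 2 * x * y * c) :
    c ≤ R ^ 2 / (2 * b ^ 2) - 1 := by
  have hb : 0 < b := by linarith
  rw [le_sub_iff_add_le, le_div_iff₀ (by positivity)]
  have h0 : x ^ 2 ≤ R ^ 2 := by gcongr
  have h1 : 0 ≤ (b - y) * (b * y + R ^ 2 - x ^ 2) := mul_nonneg (by linarith) (by nlinarith)
  have h2 : 2 * (x * y * c) * b ≤ y * (b ^ 2 + x ^ 2 - R ^ 2) := by nlinarith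
  have h3 : 2 * x * c * b ≤ b ^ 2 + x ^ 2 - R ^ 2 := by
    refine le_of_mul_le_mul_left (a := y) ?_ hy
    linarith
  have h4 : x * ((c + 1) * (2 * b ^ 2)) ≤ x * R ^ 2 := by nlinarith
  exact le_of_mul_le_mul_left h4 hx

/-- `-(R / (2 * b))` is the cosine of the supplement of the base angle of the triangle with sides
`R, b, b`. -/
theorem cos_lt_of_add {x b R c : ℝ} (hb : 0 < b) (hR : 0 < R) (hx0 : 0 ≤ x) (hx : x < b)
    (h : x ^ 2 = R ^ 2 + b ^ 2 + 2 * R * b * c) : c < -(R / (2 * b)) := by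
  rw [lt_neg, div_lt_iff₀ (by positivity)]
  have h1 : x ^ 2 < b ^ 2 := by gcongr
  have h2 : R * R < R * (-c * (2 * b)) := by linarith
  exact lt_of_mul_lt_mul_left h2 hR.le

/-- There are no five vectors of decreasing length in the plane that satisfy the distance bounds of
five consecutive best approximations whose denominators grow too slowly. -/
theorem planar_configuration {A B C D E : ℂ} (hE0 : E ≠ 0) (hED : ‖E‖ < ‖D‖) (hDC : ‖D‖ < ‖C‖)
    (hCB : ‖C‖ < ‖B‖) (hBA : ‖B‖ < ‖A‖)
    (hAB : ‖A‖ ≤ ‖A - B‖) (hAC : ‖B‖ ≤ ‖A - C‖) (hAD : ‖B‖ ≤ ‖A - D‖) (hAE : ‖B‖ ≤ ‖A - E‖)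
    (hBC : ‖A‖ ≤ ‖B - C‖) (hBD : ‖A‖ ≤ ‖B - D‖) (hBE : ‖A‖ ≤ ‖B - E‖) (hCD : ‖A‖ ≤ ‖C - D‖)
    (hCE : ‖A‖ ≤ ‖C - E‖) (hDE : ‖A‖ ≤ ‖D - E‖)
    (hACD : ‖A‖ ≤ ‖A + C - D‖) (hACE : ‖A‖ ≤ ‖A + C - E‖) (hADE : ‖A‖ ≤ ‖A + D - E‖)
    (hBCD : ‖A‖ ≤ ‖B + C - D‖) (hBCE : ‖A‖ ≤ ‖B + C - E‖) (hBDE : ‖A‖ ≤ ‖B + D - E‖)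
    (hCDE : ‖B‖ ≤ ‖C + D - E‖)
    (hABD : A + B = D ∧ ‖A‖ ≤ ‖A - C‖ ∨ ‖A‖ ≤ ‖A + B - D‖)
    (hABE : A + B = E ∧ ‖A‖ ≤ ‖A - C‖ ∨ ‖A‖ ≤ ‖A + B - E‖) : False := by
  have hE : 0 < ‖E‖ := norm_pos_iff.2 hE0
  have hD : 0 < ‖D‖ := hE.trans hED
  have hD0 : D ≠ 0 := norm_pos_iff.1 hD
  have hC : 0 < ‖C‖ := hD.trans hDC
  have hC0 : C ≠ 0 := norm_pos_iff.1 hC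
  have hB : 0 < ‖B‖ := hC.trans hCB
  have hA : 0 < ‖A‖ := hB.trans hBA
  have hA2B : ‖A‖ < 2 * ‖B‖ := by linarith [norm_sub_le B C]
  -- the base angle of the triangle with sides `‖A‖, ‖B‖, ‖B‖`
  obtain ⟨τ, hτ, hτ0, hτ3⟩ : ∃ τ, cos τ = ‖A‖ / (2 * ‖B‖) ∧ 0 ≤ τ ∧ τ < π / 3 := by
    have h1 : ‖A‖ / (2 * ‖B‖) ≤ 1 := by rw [div_le_one (by positivity)]; exact hA2B.le
    have h2 : 1 / 2 < ‖A‖ / (2 * ‖B‖) := by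
      rw [div_lt_div_iff₀ (by norm_num) (by positivity)]; linarith
    refine ⟨arccos (‖A‖ / (2 * ‖B‖)), cos_arccos (by linarith) h1, arccos_nonneg _, ?_⟩
    rw [← arccos_cos (x := π / 3) (by positivity) (by linarith [pi_pos]), cos_pi_div_three]
    exact arccos_lt_arccos (by norm_num) h2 h1
  have hπ := pi_pos
  have hcos2 : cos (2 * τ) = ‖A‖ ^ 2 / (2 * ‖B‖ ^ 2) - 1 := by
    rw [cos_two_mul, hτ]; field_simp
  -- lower bounds for the angles between the vectors, by the law of cosines
  have gapA : ∀ {X : ℂ} {α β : ℝ}, IsArg A α → IsArg X β → 0 < ‖X‖ → ‖X‖ < ‖A‖ →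
      ‖A‖ ≤ ‖A - X‖ → π / 3 < |α - β| := by
    intro X α β hα hβ hX0 hX h
    refine lt_abs_of_cos_lt (by linarith) ?_
    rw [cos_pi_div_three]
    refine cos_lt_half hX0 hX ?_
    rw [← sq_norm_sub hα hβ]; gcongr
  have gpair : ∀ {X Y : ℂ} {α β : ℝ}, IsArg X α → IsArg Y β → 0 < ‖X‖ → 0 < ‖Y‖ → ‖X‖ ≤ ‖B‖ →
      ‖Y‖ < ‖B‖ → ‖A‖ ≤ ‖X - Y‖ → π - 2 * τ < |α - β| := by
    intro X Y α β hα hβ hX0 hY0 hX hY h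
    refine lt_abs_of_cos_lt (by linarith) ?_
    rw [cos_pi_sub, hcos2, neg_sub]
    refine cos_lt_of_norm_le hX0 hY0 hX hY hBA ?_
    rw [← sq_norm_sub hα hβ]; gcongr
  have gsmall : ∀ {X : ℂ} {α β : ℝ}, IsArg A α → IsArg X β → |α - β| ≤ π → 0 < ‖X‖ →
      ‖X‖ ≤ ‖B‖ → ‖B‖ ≤ ‖A - X‖ → ‖A‖ ^ 2 - ‖B‖ ^ 2 ≤ ‖B‖ * ‖X‖ → τ ≤ |α - β| := by
    intro X α β hα hβ hαβ hX0 hX h h'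
    refine le_abs_of_cos_le hτ0 hαβ (by linarith) ?_
    rw [hτ]
    refine cos_le_of_le hX0 hX hA h' ?_
    rw [← sq_norm_sub hα hβ]; gcongr
  have gbig : ∀ {X Y : ℂ} {α β : ℝ}, IsArg Y α → IsArg X β → |α - β| ≤ π → 0 < ‖X‖ → 0 < ‖Y‖ →
      ‖X‖ ≤ ‖B‖ → ‖Y‖ ≤ ‖B‖ → ‖A‖ ≤ ‖Y - X‖ → ‖B‖ * ‖X‖ ≤ ‖A‖ ^ 2 - ‖B‖ ^ 2 →
      2 * τ ≤ |α - β| := by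
    intro X Y α β hα hβ hαβ hX0 hY0 hX hY h h'
    refine le_abs_of_cos_le (by linarith) hαβ (by linarith) ?_
    rw [hcos2]
    refine cos_le_of_ge hX0 hY0 hY (by linarith) h' ?_
    have h1 : ‖A‖ ^ 2 ≤ ‖Y - X‖ ^ 2 := by gcongr
    rw [sq_norm_sub hα hβ] at h1
    linarith
  have gsum : ∀ {X : ℂ} {α β : ℝ}, IsArg A α → IsArg B β → ‖X‖ < ‖B‖ → A + B = X →
      π - τ < |α - β| := by
    intro X α β hα hβ hX h
    refine lt_abs_of_cos_lt (by linarith) ?_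
    rw [cos_pi_sub, hτ]
    refine cos_lt_of_add hB hA (norm_nonneg X) hX ?_
    rw [← h, sq_norm_add hα hβ]
  by_cases hABE' : A + B = E ∧ ‖A‖ ≤ ‖A - C‖
  · -- `E` may lie between `A` and `B`; directions are taken relative to `D` instead
    obtain ⟨hs, hAC'⟩ := hABE'
    have hABD' : ‖A‖ ≤ ‖A + B - D‖ := by rwa [hs, norm_sub_rev]
    have hABC' : ‖A‖ ≤ ‖A + B - C‖ := by rwa [hs, norm_sub_rev]
    have aD := isArg_arg D
    obtain ⟨a, aA, ha⟩ := exists_isArg A D.arg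
    obtain ⟨b, aB, hb⟩ := exists_isArg B D.arg
    obtain ⟨c, aC, hc⟩ := exists_isArg C D.arg
    have hab : |a - b| ≤ π := abs_sub_le_pi aA aB aD ha hb hD0 hBA (by linarith) le_rfl
      (by linarith) le_rfl hBD hAD hABD'
    have hac : |a - c| ≤ π := abs_sub_le_pi aA aC aD ha hc hD0 hBA (by linarith) le_rfl
      (by linarith) hCB.le hCD hAD hACD
    have hbc : |b - c| ≤ π := abs_sub_le_pi aB aC aD hb hc hD0 hBA (by linarith) hBA.le
      (by linarith) hCB.le hCD (hBA.le.trans hBD) hBCD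
    refine three_directions hτ3 hac hbc (gsum aA aB (by linarith) hs)
      (gapA aA aC hC (by linarith) hAC') ?_ (notMem_uIcc aA aB aC hab hC0 hBA (by linarith) le_rfl
      (by linarith) le_rfl hBC hAC hABC')
    have := gpair aB aC hB hC le_rfl hCB hBC
    linarith
  · have hABE' := hABE.resolve_left hABE'
    have aE := isArg_arg E
    obtain ⟨a, aA, ha⟩ := exists_isArg A E.arg
    obtain ⟨b, aB, hb⟩ := exists_isArg B E.arg
    obtain ⟨c, aC, hc⟩ := exists_isArg C E.arg
    obtain ⟨d, aD, hd⟩ := exists_isArg D E.arg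
    have hab : |a - b| ≤ π := abs_sub_le_pi aA aB aE ha hb hE0 hBA (by linarith) le_rfl
      (by linarith) le_rfl hBE hAE hABE'
    have hac : |a - c| ≤ π := abs_sub_le_pi aA aC aE ha hc hE0 hBA (by linarith) le_rfl
      (by linarith) hCB.le hCE hAE hACE
    have had : |a - d| ≤ π := abs_sub_le_pi aA aD aE ha hd hE0 hBA (by linarith) le_rfl
      (by linarith) (by linarith) hDE hAE hADE
    have hbc : |b - c| ≤ π := abs_sub_le_pi aB aC aE hb hc hE0 hBA (by linarith) hBA.le
      (by linarith) hCB.le hCE (by linarith) hBCE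
    have hbd : |b - d| ≤ π := abs_sub_le_pi aB aD aE hb hd hE0 hBA (by linarith) hBA.le
      (by linarith) (by linarith) hDE (by linarith) hBDE
    have hcd : |c - d| ≤ π := abs_sub_le_pi aC aD aE hc hd hE0 hCB (by linarith) hCB.le
      (by linarith) (by linarith) (by linarith) (by linarith) hCDE
    have gac : ‖A‖ ≤ ‖A - C‖ → π / 3 < |a - c| := gapA aA aC hC (by linarith)
    have gbc := gpair aB aC hB hC le_rfl hCB hBC
    by_cases hABD' : A + B = D ∧ ‖A‖ ≤ ‖A - C‖
    · obtain ⟨hs, hAC'⟩ := hABD'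
      have hABC' : ‖A‖ ≤ ‖A + B - C‖ := by rwa [hs, norm_sub_rev]
      exact three_directions hτ3 hac hbc (gsum aA aB (by linarith) hs) (gac hAC') (by linarith)
        (notMem_uIcc aA aB aC hab hC0 hBA (by linarith) le_rfl (by linarith) le_rfl hBC hAC hABC')
    · have hABD' := hABD.resolve_left hABD'
      refine four_directions hτ3 had hbd hcd (gapA aA aB hB hBA hAB) gbc
        (gpair aB aD hB hD le_rfl (by linarith) hBD)
        (gpair aC aD hC hD hCB.le (by linarith) hCD) ?_ ?_
        (notMem_uIcc aA aB aD hab hD0 hBA (by linarith) le_rfl (by linarith) le_rfl hBD hAD hABD')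
        (notMem_uIcc aB aC aD hbc hD0 hBA (by linarith) hBA.le hDC.le hCB.le hCD (by linarith)
          hBCD)
      · rcases le_total (‖A‖ ^ 2 - ‖B‖ ^ 2) (‖B‖ * ‖C‖) with h | h
        · exact Or.inl (gsmall aA aC hac hC hCB.le hAC h)
        · exact Or.inr (gbig aB aC hbc hC hB hCB.le le_rfl hBC h)
      · rcases le_total (‖A‖ ^ 2 - ‖B‖ ^ 2) (‖B‖ * ‖D‖) with h | h
        · exact Or.inl (gsmall aA aD had hD (by linarith) hAD h)
        · exact Or.inr ⟨gbig aB aD hbd hD hB (by linarith) le_rfl hBD h,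
            gbig aC aD hcd hD hC (by linarith) hCB.le hCD h⟩

end PlaneGeometry

/-! ### Residues and best approximations -/

/-- The vector `q α - p` of the plane, as a complex number. -/
noncomputable def residue (α : EuclideanSpace ℝ (Fin 2)) (q : ℤ) (p : Fin 2 → ℤ) : ℂ :=
  ⟨q * α 0 - p 0, q * α 1 - p 1⟩

section

variable {α : EuclideanSpace ℝ (Fin 2)}

theorem residue_add (q q' : ℤ) (p p' : Fin 2 → ℤ) :
    residue α q p + residue α q' p' = residue α (q + q') (p + p') := by
  apply Complex.ext <;> simp [residue] <;> ring

theorem residue_sub (q q' : ℤ) (p p' : Fin 2 → ℤ) :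
    residue α q p - residue α q' p' = residue α (q - q') (p - p') := by
  apply Complex.ext <;> simp [residue] <;> ring

theorem norm_residue (q : ℕ) (p : Fin 2 → ℤ) :
    ‖residue α q p‖ = ‖(q : ℝ) • α - intPoint p‖ := by
  rw [EuclideanSpace.norm_eq, Complex.norm_eq_sqrt_sq_add_sq, Fin.sum_univ_two]
  simp [residue, intPoint]

theorem delta_le_norm_residue (q : ℤ) (p : Fin 2 → ℤ) : delta α q.natAbs ≤ ‖residue α q p‖ := by
  have key : ∀ (n : ℕ) (p : Fin 2 → ℤ), delta α n ≤ ‖residue α n p‖ := fun n p => by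
    rw [norm_residue]
    exact ciInf_le ⟨0, by rintro _ ⟨p, rfl⟩; exact norm_nonneg _⟩ p
  rcases Int.natAbs_eq q with h | h
  · rw [h]; exact key _ p
  · have h' : residue α q p = -residue α q.natAbs (-p) := by
      conv_lhs => rw [h]
      apply Complex.ext <;> simp [residue] <;> ring
    rw [h', norm_neg]; exact key _ _

theorem exists_delta_eq_norm_residue (α : EuclideanSpace ℝ (Fin 2)) (q : ℕ) :
    ∃ p : Fin 2 → ℤ, ‖residue α q p‖ = delta α q := by
  obtain ⟨p, hp⟩ := exists_delta_eq α q
  exact ⟨p, by rw [norm_residue, hp]⟩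

theorem delta_lt_one (α : EuclideanSpace ℝ (Fin 2)) (q : ℕ) : delta α q < 1 := by
  refine (delta_le_norm_residue (q : ℤ) fun i => round (q * α i)).trans_lt ?_
  rw [← sq_lt_one_iff₀ (norm_nonneg _), Complex.sq_norm, Complex.normSq_apply]
  have h0 := abs_sub_round (q * α 0)
  have h1 := abs_sub_round (q * α 1)
  rw [abs_le] at h0 h1
  simp only [residue, Int.cast_natCast]
  nlinarith

theorem one_le_norm_residue_zero {p : Fin 2 → ℤ} (hp : p ≠ 0) : 1 ≤ ‖residue α 0 p‖ := by
  obtain ⟨i, hi⟩ := Function.ne_iff.1 hp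
  have hi : (1 : ℝ) ≤ |(p i : ℝ)| := by exact_mod_cast Int.one_le_abs hi
  refine hi.trans ?_
  fin_cases i
  · simpa [residue] using Complex.abs_re_le_norm (residue α 0 p)
  · simpa [residue] using Complex.abs_im_le_norm (residue α 0 p)

theorem delta_pos (hα : ∃ i, Irrational (α i)) {q : ℕ} (hq : 1 ≤ q) : 0 < delta α q := by
  obtain ⟨p, hp⟩ := exists_delta_eq_norm_residue α q
  rw [← hp, norm_pos_iff]
  intro h
  obtain ⟨i, hi⟩ := hα
  have h' : (q : ℝ) * α i - p i = 0 := by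
    fin_cases i
    · simpa [residue] using congrArg Complex.re h
    · simpa [residue] using congrArg Complex.im h
  exact (irrational_natCast_mul_iff.2 ⟨Nat.one_le_iff_ne_zero.1 hq, hi⟩).ne_int (p i)
    (sub_eq_zero.1 h')

/-- Dirichlet's theorem without a rate: among the multiples of `α`, reduced modulo the integer
lattice, some two are close to each other. -/
theorem exists_delta_lt (α : EuclideanSpace ℝ (Fin 2)) {ε : ℝ} (hε : 0 < ε) :
    ∃ q : ℕ, 1 ≤ q ∧ delta α q < ε := by
  let f : ℕ → ℂ := fun n => residue α n fun i => ⌊n * α i⌋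
  have hf : ∀ n, f n ∈ Metric.closedBall (0 : ℂ) 2 := fun n => by
    rw [mem_closedBall_zero_iff]
    refine (Complex.norm_le_abs_re_add_abs_im _).trans ?_
    have h : ∀ x : ℝ, |x - ⌊x⌋| ≤ 1 := fun x => by
      rw [Int.self_sub_floor, abs_of_nonneg (Int.fract_nonneg x)]
      exact (Int.fract_lt_one x).le
    have h0 := h (n * α 0)
    have h1 := h (n * α 1)
    simp only [f, residue, Int.cast_natCast]
    linarith
  obtain ⟨a, -, φ, hφ, ha⟩ := tendsto_subseq_of_bounded Metric.isBounded_closedBall hf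
  obtain ⟨N, hN⟩ := Metric.cauchySeq_iff.1 ha.cauchySeq ε hε
  have h := hN (N + 1) (by omega) N le_rfl
  have hlt : φ N < φ (N + 1) := hφ (by omega)
  refine ⟨((φ (N + 1) : ℤ) - φ N).natAbs, by omega, ?_⟩
  rw [dist_eq_norm, Function.comp, Function.comp, residue_sub] at h
  exact (delta_le_norm_residue _ _).trans_lt h

theorem infinite_isBestDenominator (hα : ∃ i, Irrational (α i)) :
    {q | IsBestDenominator α q}.Infinite := by
  classical
  rw [Set.infinite_iff_exists_gt]
  intro N
  -- the least denominator that is better than all those up to `N` belongs to a best approximation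
  have hex : ∃ m : ℕ, 1 ≤ m ∧ ∀ q, 1 ≤ q → q ≤ N → delta α m < delta α q := by
    obtain ⟨q₀, hq₀, hmin⟩ := Finset.exists_min_image (Finset.Icc 1 (N + 1)) (delta α)
      ⟨1, by simp⟩
    rw [Finset.mem_Icc] at hq₀
    obtain ⟨m, hm, hlt⟩ := exists_delta_lt α (delta_pos hα hq₀.1)
    exact ⟨m, hm, fun q h h' => hlt.trans_le (hmin q (Finset.mem_Icc.2 ⟨h, by omega⟩))⟩
  obtain ⟨h1, h2⟩ := Nat.find_spec hex
  refine ⟨Nat.find hex, ⟨h1, fun q hq hqm => ?_⟩, ?_⟩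
  · have := Nat.find_min hex hqm
    push Not at this
    obtain ⟨q', hq', hq'N, hle⟩ := this hq
    exact (h2 q' hq' hq'N).trans_le hle
  · by_contra! h
    exact (h2 _ h1 h).false

/-- The extremal property of best approximations: no nonzero integer vector `(q, p)` with
`|q| < Q (j + 1)` has a residue shorter than that of the `j`-th best approximation. For `q = 0`
it holds since `delta` is less than `1`. -/
theorem delta_nth_le_norm_residue (hα : ∃ i, Irrational (α i)) (j : ℕ) {q : ℤ} {p : Fin 2 → ℤ}
    (hqp : q ≠ 0 ∨ p ≠ 0) (hq : |q| < (Nat.nth (IsBestDenominator α) (j + 1) : ℕ)) :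
    delta α (Nat.nth (IsBestDenominator α) j) ≤ ‖residue α q p‖ := by
  classical
  have hinf := infinite_isBestDenominator hα
  by_cases hq0 : q = 0
  · subst hq0
    exact (delta_lt_one α _).le.trans (one_le_norm_residue_zero (hqp.resolve_left (by simp)))
  refine le_trans ?_ (delta_le_norm_residue q p)
  by_contra! hlt
  -- the least denominator better than `Q j` is that of a best approximation between `Q j` and
  -- `Q (j + 1)`
  have hex : ∃ m : ℕ, 1 ≤ m ∧ delta α m < delta α (Nat.nth (IsBestDenominator α) j) :=
    ⟨q.natAbs, by omega, hlt⟩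
  obtain ⟨h1, h2⟩ := Nat.find_spec hex
  have hle : Nat.find hex ≤ q.natAbs := Nat.find_min' hex ⟨by omega, hlt⟩
  have hbest : IsBestDenominator α (Nat.find hex) := ⟨h1, fun q' hq' hlt' => by
    have := Nat.find_min hex hlt'
    push Not at this
    exact h2.trans_le (this hq')⟩
  have hjm : Nat.nth (IsBestDenominator α) j < Nat.find hex := by
    by_contra! h
    rcases h.lt_or_eq with h | h
    · exact (((Nat.nth_mem_of_infinite hinf j).2 _ h1 h).trans h2).false
    · rw [h] at h2; exact h2.false
  have hmj : Nat.find hex < Nat.nth (IsBestDenominator α) (j + 1) := by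
    rw [abs_lt] at hq; omega
  rw [← Nat.nth_count hbest] at hjm hmj
  have h3 := (Nat.nth_strictMono hinf).lt_iff_lt.1 hjm
  have h4 := (Nat.nth_strictMono hinf).lt_iff_lt.1 hmj
  omega

/-- The recursive inequality for the denominators of best approximations. -/
theorem min_le_nth_isBestDenominator (hα : ∃ i, Irrational (α i)) (k : ℕ) :
    2 * Nat.nth (IsBestDenominator α) (k + 1) ≤ Nat.nth (IsBestDenominator α) (k + 4) ∨
      Nat.nth (IsBestDenominator α) k + Nat.nth (IsBestDenominator α) (k + 2) ≤
        Nat.nth (IsBestDenominator α) (k + 4) := by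
  by_contra! h
  have hinf := infinite_isBestDenominator hα
  have key := @delta_nth_le_norm_residue α hα
  have hmem := Nat.nth_mem_of_infinite hinf
  have hmono := Nat.nth_strictMono hinf
  generalize Nat.nth (IsBestDenominator α) = Q at *
  have hδ : ∀ {i j}, i < j → delta α (Q j) < delta α (Q i) := fun {i j} hij =>
    (hmem j).2 _ (hmem i).1 (hmono hij)
  choose p hp using fun i => exists_delta_eq_norm_residue α (Q i)
  have q0 := (hmem k).1
  have q01 := hmono (show k < k + 1 by omega)
  have q12 := hmono (show k + 1 < k + 2 by omega)
  have q23 := hmono (show k + 2 < k + 3 by omega)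
  have q34 := hmono (show k + 3 < k + 4 by omega)
  obtain ⟨h1, h2⟩ := h
  -- lower bounds for the residues of small combinations of the five best approximations
  have two : ∀ j m n, m ≠ n → |(Q m : ℤ) - Q n| < Q (j + 1) →
      ‖residue α (Q j) (p j)‖ ≤ ‖residue α (Q m) (p m) - residue α (Q n) (p n)‖ := by
    intro j m n hmn hq
    rw [hp, residue_sub]
    exact key j (Or.inl (by have := hmono.injective.ne hmn; omega)) hq
  have three : ∀ j l m n, (Q l : ℤ) + Q m - Q n ≠ 0 → |(Q l : ℤ) + Q m - Q n| < Q (j + 1) →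
      ‖residue α (Q j) (p j)‖ ≤
        ‖residue α (Q l) (p l) + residue α (Q m) (p m) - residue α (Q n) (p n)‖ := by
    intro j l m n h0 hq
    rw [hp, residue_add, residue_sub]
    exact key j (Or.inl h0) hq
  have special : ∀ n, k + 2 < n → n ≤ k + 4 →
      residue α (Q k) (p k) + residue α (Q (k + 1)) (p (k + 1)) = residue α (Q n) (p n) ∧
          ‖residue α (Q k) (p k)‖ ≤
            ‖residue α (Q k) (p k) - residue α (Q (k + 2)) (p (k + 2))‖ ∨
        ‖residue α (Q k) (p k)‖ ≤ ‖residue α (Q k) (p k) +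
          residue α (Q (k + 1)) (p (k + 1)) - residue α (Q n) (p n)‖ := by
    intro n hn hn'
    have hn1 := hmono hn
    have hn2 := hmono.monotone hn'
    by_cases h0 : (Q k : ℤ) + Q (k + 1) - Q n ≠ 0 ∨ p k + p (k + 1) - p n ≠ 0
    · right
      rw [hp, residue_add, residue_sub]
      exact key k h0 (by rw [abs_lt]; omega)
    · -- now `Q n = Q k + Q (k + 1)`, so that `Q (k + 2) - Q k < Q (k + 1)`
      left
      push Not at h0
      refine ⟨?_, two k k (k + 2) (by omega) (by rw [abs_lt]; omega)⟩
      rw [residue_add, sub_eq_zero.1 h0.1, sub_eq_zero.1 h0.2]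
  have hpos : residue α (Q (k + 4)) (p (k + 4)) ≠ 0 := by
    rw [← norm_pos_iff, hp]; exact delta_pos hα (hmem _).1
  have hlt : ∀ i, ‖residue α (Q (i + 1)) (p (i + 1))‖ < ‖residue α (Q i) (p i)‖ := fun i => by
    rw [hp, hp]; exact hδ (by omega)
  refine planar_configuration hpos (hlt (k + 3)) (hlt (k + 2)) (hlt (k + 1)) (hlt k)
    (two k k (k + 1) ?_ ?_) (two (k + 1) k (k + 2) ?_ ?_) (two (k + 1) k (k + 3) ?_ ?_)
    (two (k + 1) k (k + 4) ?_ ?_) (two k (k + 1) (k + 2) ?_ ?_) (two k (k + 1) (k + 3) ?_ ?_)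
    (two k (k + 1) (k + 4) ?_ ?_) (two k (k + 2) (k + 3) ?_ ?_) (two k (k + 2) (k + 4) ?_ ?_)
    (two k (k + 3) (k + 4) ?_ ?_) (three k k (k + 2) (k + 3) ?_ ?_)
    (three k k (k + 2) (k + 4) ?_ ?_) (three k k (k + 3) (k + 4) ?_ ?_)
    (three k (k + 1) (k + 2) (k + 3) ?_ ?_) (three k (k + 1) (k + 2) (k + 4) ?_ ?_)
    (three k (k + 1) (k + 3) (k + 4) ?_ ?_) (three (k + 1) (k + 2) (k + 3) (k + 4) ?_ ?_)
    (special (k + 3) (by omega) (by omega)) (special (k + 4) (by omega) (by omega))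
  all_goals
    try rw [abs_lt]
    try simp only [add_assoc, Nat.reduceAdd]
    omega

/-! ### Growth of the denominators -/

/-- The factor `64 / 125 = (5 / 4) ^ (-3)` makes the bound trivial for `k ≤ 3`. -/
theorem pow_le_nth_isBestDenominator (hα : ∃ i, Irrational (α i)) (k : ℕ) :
    64 / 125 * (5 / 4 : ℝ) ^ k ≤ Nat.nth (IsBestDenominator α) k := by
  induction k using Nat.strong_induction_on with
  | _ k ih =>
    rcases lt_or_ge k 4 with hk | hk
    · have h1 : (1 : ℝ) ≤ Nat.nth (IsBestDenominator α) k := by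
        exact_mod_cast (Nat.nth_mem_of_infinite (infinite_isBestDenominator hα) k).1
      refine le_trans ?_ h1
      interval_cases k <;> norm_num
    · obtain ⟨n, rfl⟩ := Nat.exists_eq_add_of_le' hk
      have h0 := ih n (by omega)
      have h1 := ih (n + 1) (by omega)
      have h2 := ih (n + 2) (by omega)
      have hpos : (0 : ℝ) < (5 / 4) ^ n := by positivity
      rw [pow_add] at h1 h2 ⊢
      rcases min_le_nth_isBestDenominator hα n with h | h
      · have h : (2 * Nat.nth (IsBestDenominator α) (n + 1) : ℝ) ≤
            Nat.nth (IsBestDenominator α) (n + 4) := by exact_mod_cast h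
        linarith
      · have h : (Nat.nth (IsBestDenominator α) n + Nat.nth (IsBestDenominator α) (n + 2) : ℝ) ≤
            Nat.nth (IsBestDenominator α) (n + 4) := by exact_mod_cast h
        linarith

theorem le_growthExponent (hα : ∃ i, Irrational (α i)) {x : ℝ} (hx0 : 0 < x) (hx : x < 5 / 4) :
    (x : EReal) ≤ growthExponent α := by
  have hlim : Tendsto (fun k : ℕ => 64 / 125 * (4 / 5) * ((5 / 4) / x) ^ k) atTop atTop :=
    (tendsto_pow_atTop_atTop_of_one_lt ((one_lt_div hx0).2 hx)).const_mul_atTop (by norm_num)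
  refine le_liminf_of_le (by isBoundedDefault) ?_
  filter_upwards [hlim.eventually_ge_atTop 1, eventually_ge_atTop 1] with k hk hk1
  rw [EReal.coe_le_coe_iff, one_div]
  have hk0 : k ≠ 0 := by omega
  rw [Real.le_rpow_inv_iff_of_pos hx0.le (by positivity) (by positivity), Real.rpow_natCast]
  obtain ⟨n, rfl⟩ := Nat.exists_eq_add_of_le' hk1
  have h := pow_le_nth_isBestDenominator hα n
  rw [bestDenominator, Nat.add_sub_cancel]
  refine le_trans ?_ h
  rw [div_pow, mul_div_assoc', le_div_iff₀ (by positivity), one_mul, pow_succ (5 / 4 : ℝ)] at hk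
  linarith

end

theorem theorem3 :
    ((1.228043 : ℝ) : EReal) ≤ minGrowthExponent 2 ∧
    ∀ α : EuclideanSpace ℝ (Fin 2), (∃ i, Irrational (α i)) →
      ((1.228043 : ℝ) : EReal) ≤
        liminf (fun k : ℕ => (((bestDenominator α k : ℝ) ^ (1 / (k : ℝ)) : ℝ) : EReal)) atTop :=
  ⟨le_iInf fun α => le_growthExponent α.2 (by norm_num) (by norm_num),
    fun _ hα => le_growthExponent hα (by norm_num) (by norm_num)⟩
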